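/- **Frameworks.** A bipolar set-argumentation framework (BSAF) is a triple $F=(A,R,S)$ with $A$ a finite set (of arguments) and $R,S\subseteq 2^A\times A$ (attacks and supports). For $E\subseteq A$ and a set $L$ of pairs (set, argument) put $E^+_L=\{h\mid \exists T\subseteq E:(T,h)\in L\}$; $E$ attacks $D$ if $E^+_R\cap D\neq\emptyset$, and $E$ attacks $a$ if $a\in E^+_R$. Let $\mathrm{supp}_F(E)=E\cup\{h\in A\mid \exists (T,h)\in S: T\subseteq E\}$ and $\mathrm{cl}_F(E)=\bigcup_{i\ge 1}\mathrm{supp}_F^i(E)$; $E$ is closed if $\mathrm{cl}_F(E)=E$. $E$ defends $a$ if $E$ attacks every closed set $D\subseteq A$ that attacks $a$. $E\subseteq A$ is admissible if it does not attack itself, is closed and defends each of its elements; complete if it is admissible and contains every argument it defends. $\mathrm{grd}(F)$ is the set of $\subseteq$-minimal complete sets, $\mathrm{pref}(F)$ the set of $\subseteq$-maximal admissible sets. $G=(A',R',S')$ is a sub-framework of $F$ if $A'\subseteq A$, $R'\subseteq R$, $S'\subseteq S$. **Splittings.** A splitting of $F$ is a tuple $(F_1,F_2,R_3,S_3)$ where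 $F_i=(A_i,R_i,S_i)$ are BSAFs that are sub-frameworks of $F$, $A_1\cap A_2=\emptyset$, $A=A_1\cup A_2$, $R=R_1\cup R_2\cup R_3$, $S=S_1\cup S_2\cup S_3$, every $(T,h)\in R_3$ satisfies $T\cap A_1\ne\emptyset$ and $h\in A_2$, and every $(T,h)\in S_3$ satisfies $T\cap A_2\neq\emptyset$ and $h\in A_1$. **The framework $F_2^\circledast$.** Let $*_0,*_1,*_2$ be pairwise distinct and not in $A$, and let $E_1\subseteq A_1$. For $i=2,3$ let $R_i^c=\{(\mathrm{cl}_F(T),h)\mid (T,h)\in R_i\}$, and put $\hat R_2=\{(T,h)\in R_2^c\mid T\cap A_1=\emptyset\}$, $\hat R_3=\{(T,h)\in R_2^c\cup R_3^c\mid T\cap A_1\ne\emptyset\}$. Let $F_2^\star=(A_2\cup\{*_0\},R_2^\star,S_2)$, where $R_2^\star$ consists of - all elements of $\hat R_2$; - all $(T\cap A_2,h)$ with $(T,h)\in\hat R_3$, $T\cap (E_1)^+_{R_1\cup\hat R_3}=\emptyset$ and $T\cap A_1\subseteq E_1$; - $(\{*_0\},*_0)$; - all $((T\cap A_2)\cup\{*_0\},h)$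 with $(T,h)\in\hat R_3$, $T\cap (E_1)^+_{R_1\cup\hat R_2\cup\hat R_3}=\emptyset$ and $T\cap A_1\not\subseteq E_1$. Let $\mathcal T$ be the set of all $T$ such that $(T,h)\in S_3$, $T\cap A_1\subseteq E_1$ and $h\notin E_1$ for some $h$, and let $\mathcal D$ be the set of all $T\in\mathcal T$ with $T\cap A_1=\emptyset$ and $\mathrm{cl}_F(T)\cap (E_1)^+_{R_1\cup R_2^\star}\ne\emptyset$. The framework $F_2^\circledast$ is obtained from $F_2^\star$ as follows: - if $\mathcal D\neq\emptyset$, add the argument $*_1$, the attack $(\emptyset,*_1)$ and the supports $(T\cap A_2,*_1)$ for $T\in\mathcal D$; - if $\mathcal T\setminus\mathcal D\ne\emptyset$, add the argument $*_2$, the attacks $((T\cap A_2)\cup\{*_2\},*_2)$ and the supports $(T\cap A_2,*_2)$ for $T\in\mathcal T\setminus\mathcal D$. **Theorem.** Let $(F_1,F_2,R_3,S_3)$ be a splitting of a BSAF $F$ such that no support in $S_2$ has an empty tail (equivalently, there is no $(T,h)\in S$ with $T\subseteq A_1$ and $h\in A_2$). Let $\sigma\in\{\mathrm{grd},\mathrm{pref}\}$.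 If $E_1\in\sigma(F_1)$ and $E_2\in\sigma(F_2^\circledast)$, where $F_2^\circledast$ is formed with respect to $E_1$, then $E_1\cup(E_2\setminus\{*_2\})\in\sigma(F)$. -/

import Mathlib

/-- A bipolar set-argumentation framework: a finite set of arguments (elements of `α`), an attack
relation and a support relation, both between sets of arguments (tails) and arguments (heads). -/
@[ext]
structure BSAF (α : Type*) where
  args : Set α
  att : Set (Set α × α)
  sup : Set (Set α × α)
  finite_args : args.Finite
  att_sub : ∀ p ∈ att, p.1 ⊆ args ∧ p.2 ∈ args
  sup_sub : ∀ p ∈ sup, p.1 ⊆ args ∧ p.2 ∈ args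

/-- `E⁺_R`: the heads of all links of `R` whose tail is contained in `E`. -/
def attackedBy {α : Type*} (R : Set (Set α × α)) (E : Set α) : Set α :=
  {h | ∃ T, T ⊆ E ∧ (T, h) ∈ R}

namespace BSAF

variable {α : Type*}

/-- One step of support. -/
def supp (F : BSAF α) (E : Set α) : Set α :=
  E ∪ {h | h ∈ F.args ∧ ∃ T, (T, h) ∈ F.sup ∧ T ⊆ E}

/-- The closure of `E`: the union of all iterates `supp^i (E)`, `i ≥ 1`. -/
def cl (F : BSAF α) (E : Set α) : Set α :=
  ⋃ i ∈ {i : ℕ | 1 ≤ i}, (F.supp)^[i] E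

def IsClosed (F : BSAF α) (E : Set α) : Prop :=
  F.cl E = E

/-- `E` attacks some element of `D`. -/
def Attacks (F : BSAF α) (E D : Set α) : Prop :=
  ∃ a ∈ D, a ∈ attackedBy F.att E

/-- `E` defends `a`: `E` attacks every closed set that attacks `a`. -/
def Defends (F : BSAF α) (E : Set α) (a : α) : Prop :=
  ∀ D, D ⊆ F.args → F.IsClosed D → a ∈ attackedBy F.att D → F.Attacks E D

def ConflictFree (F : BSAF α) (E : Set α) : Prop :=
  E ⊆ F.args ∧ ¬ F.Attacks E E

def Admissible (F : BSAF α) (E : Set α) : Prop :=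
  F.ConflictFree E ∧ F.IsClosed E ∧ ∀ a ∈ E, F.Defends E a

def Complete (F : BSAF α) (E : Set α) : Prop :=
  F.Admissible E ∧ ∀ a ∈ F.args, F.Defends E a → a ∈ E

/-- Grounded extensions: the `⊆`-minimal complete sets. -/
def Grounded (F : BSAF α) (E : Set α) : Prop :=
  Minimal F.Complete E

/-- Preferred extensions: the `⊆`-maximal admissible sets. -/
def Preferred (F : BSAF α) (E : Set α) : Prop :=
  Maximal F.Admissible E

/-- `G` is a sub-framework of `F`. -/
def IsSub (G F : BSAF α) : Prop :=
  G.args ⊆ F.args ∧ G.att ⊆ F.att ∧ G.sup ⊆ F.sup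

/-- Componentwise union of two frameworks. -/
def union (F G : BSAF α) : BSAF α where
  args := F.args ∪ G.args
  att := F.att ∪ G.att
  sup := F.sup ∪ G.sup
  finite_args := F.finite_args.union G.finite_args
  att_sub := by
    rintro p (hp | hp)
    · exact ⟨(F.att_sub p hp).1.trans Set.subset_union_left, Or.inl (F.att_sub p hp).2⟩
    · exact ⟨(G.att_sub p hp).1.trans Set.subset_union_right, Or.inr (G.att_sub p hp).2⟩
  sup_sub := by
    rintro p (hp | hp)
    · exact ⟨(F.sup_sub p hp).1.trans Set.subset_union_left, Or.inl (F.sup_sub p hp).2⟩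
    · exact ⟨(G.sup_sub p hp).1.trans Set.subset_union_right, Or.inr (G.sup_sub p hp).2⟩

theorem supp_subset (F : BSAF α) {E : Set α} (hE : E ⊆ F.args) : F.supp E ⊆ F.args := by
  rintro x (hx | hx)
  · exact hE hx
  · exact hx.1

theorem iterate_supp_subset (F : BSAF α) {E : Set α} (hE : E ⊆ F.args) (i : ℕ) :
    (F.supp)^[i] E ⊆ F.args := by
  induction i with
  | zero => simpa using hE
  | succ n ih => rw [Function.iterate_succ_apply']; exact F.supp_subset ih

theorem cl_subset (F : BSAF α) {E : Set α} (hE : E ⊆ F.args) : F.cl E ⊆ F.args :=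
  Set.iUnion₂_subset fun i _ => F.iterate_supp_subset hE i

/-- The set of closed links: each link `(T, h)` of `L` is replaced by `(cl (T), h)`, where the
closure is computed in `F`. -/
def closeLinks (F : BSAF α) (L : Set (Set α × α)) : Set (Set α × α) :=
  {p | ∃ T h, (T, h) ∈ L ∧ p = (F.cl T, h)}

theorem closeLinks_sub (F : BSAF α) {L : Set (Set α × α)} {B : Set α}
    (hL : ∀ p ∈ L, p.1 ⊆ F.args ∧ p.2 ∈ B) : ∀ p ∈ F.closeLinks L, p.1 ⊆ F.args ∧ p.2 ∈ B := by
  rintro _ ⟨T, h, hTh, rfl⟩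
  exact ⟨F.cl_subset (hL _ hTh).1, (hL _ hTh).2⟩

end BSAF

/-! ### Attack splittings, R-reduct and modification -/

/-- An attack splitting `(F₁, F₂, R₃)` of `F`. -/
structure AttackSplitting {α : Type*} (F : BSAF α) where
  F₁ : BSAF α
  F₂ : BSAF α
  R₃ : Set (Set α × α)
  sub₁ : F₁.IsSub F
  sub₂ : F₂.IsSub F
  disj : F₁.args ∩ F₂.args = ∅
  args_eq : F.args = F₁.args ∪ F₂.args
  sup_eq : F.sup = F₁.sup ∪ F₂.sup
  att_eq : F.att = F₁.att ∪ F₂.att ∪ R₃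
  R₃_sub : R₃ ⊆ {p | p ∈ F.att ∧ p.1 ∩ F₁.args ≠ ∅ ∧ p.1 ⊆ F.args ∧ p.2 ∈ F₂.args}

namespace AttackSplitting

variable {α : Type*} {F : BSAF α}

/-- The undecided links with respect to `E₁`: no element of the tail is defeated by `E₁`, but the
part of the tail in `F₁` is not contained in `E₁`. -/
def undecided (σ : AttackSplitting F) (E₁ : Set α) : Set (Set α × α) :=
  {p | p ∈ σ.R₃ ∧ p.1 ∩ attackedBy F.att E₁ = ∅ ∧ ¬ p.1 ∩ σ.F₁.args ⊆ E₁}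

/-- The R-reduct of `F₂` with respect to `E₁`, for a splitting whose negative links `R₃` have
already been closed. -/
def rReduct (σ : AttackSplitting F) (E₁ : Set α) : BSAF α where
  args := σ.F₂.args
  att := σ.F₂.att ∪ {p | ∃ T h, (T, h) ∈ σ.R₃ ∧ T ∩ attackedBy (σ.F₁.att ∪ σ.R₃) E₁ = ∅ ∧
    T ∩ σ.F₁.args ⊆ E₁ ∧ p = (T ∩ σ.F₂.args, h)}
  sup := σ.F₂.sup
  finite_args := σ.F₂.finite_args
  att_sub := by
    rintro p (hp | ⟨T, h, hTh, -, -, rfl⟩)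
    · exact σ.F₂.att_sub p hp
    · exact ⟨Set.inter_subset_right, (σ.R₃_sub hTh).2.2.2⟩
  sup_sub := σ.F₂.sup_sub

/-- The modification of the R-reduct of `F₂` with respect to `E₁`: a self-attacking argument `s₀`
(written `*₀`) is added, and it joins the projections of the undecided links. -/
def modification (σ : AttackSplitting F) (E₁ : Set α) (s₀ : α) : BSAF α where
  args := σ.F₂.args ∪ {s₀}
  att := (σ.rReduct E₁).att ∪ {({s₀}, s₀)} ∪
    {p | ∃ T h, (T, h) ∈ σ.undecided E₁ ∧ p = (T ∩ σ.F₂.args ∪ {s₀}, h)}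
  sup := σ.F₂.sup
  finite_args := σ.F₂.finite_args.union (Set.finite_singleton s₀)
  att_sub := by
    rintro p ((hp | rfl) | ⟨T, h, hTh, rfl⟩)
    · have := (σ.rReduct E₁).att_sub p hp
      exact ⟨this.1.trans Set.subset_union_left, Or.inl this.2⟩
    · exact ⟨Set.subset_union_right, Or.inr rfl⟩
    · exact ⟨Set.union_subset_union_left _ Set.inter_subset_right,
        Or.inl (σ.R₃_sub hTh.1).2.2.2⟩
  sup_sub := fun p hp =>
    ⟨(σ.F₂.sup_sub p hp).1.trans Set.subset_union_left, Or.inl (σ.F₂.sup_sub p hp).2⟩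

end AttackSplitting

/-! ### Support splittings and S-reduct -/

/-- A (backward) support splitting `(F₁, F₂, S₃)` of `F`. -/
structure SupportSplitting {α : Type*} (F : BSAF α) where
  F₁ : BSAF α
  F₂ : BSAF α
  S₃ : Set (Set α × α)
  sub₁ : F₁.IsSub F
  sub₂ : F₂.IsSub F
  disj : F₁.args ∩ F₂.args = ∅
  args_eq : F.args = F₁.args ∪ F₂.args
  att_eq : F.att = F₁.att ∪ F₂.att
  sup_eq : F.sup = F₁.sup ∪ F₂.sup ∪ S₃
  S₃_sub : S₃ ⊆ {p | p ∈ F.sup ∧ p.1 ∩ F₂.args ≠ ∅ ∧ p.1 ⊆ F.args ∧ p.2 ∈ F₁.args}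

namespace SupportSplitting

variable {α : Type*} {F : BSAF α}

/-- `𝒯_{S₃}(E₁)`: the sets that are support-incompatible with respect to `E₁`. -/
def incompatible (σ : SupportSplitting F) (E₁ : Set α) : Set (Set α) :=
  {T | T ⊆ F.args ∧ ∃ h ∈ σ.F₁.args, (T, h) ∈ σ.S₃ ∧ T ∩ σ.F₁.args ⊆ E₁ ∧ h ∉ E₁}

/-- `𝒟_{S₃}(E₁)`: the sets that are closure-defeated with respect to `E₁`. -/
def closureDefeated (σ : SupportSplitting F) (E₁ : Set α) : Set (Set α) :=
  {T | T ∈ σ.incompatible E₁ ∧ T ∩ σ.F₁.args = ∅ ∧ F.cl T ∩ attackedBy F.att E₁ ≠ ∅}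

open Classical in
/-- The type-1-modification of `F₂`: unless there are no closure-defeated sets, a new argument `s₁`
(written `*₁`) is added, attacked by the empty set and supported by the closure-defeated sets. -/
noncomputable def type1 (σ : SupportSplitting F) (E₁ : Set α) (s₁ : α) : BSAF α :=
  if σ.closureDefeated E₁ = ∅ then σ.F₂ else
  { args := σ.F₂.args ∪ {s₁}
    att := σ.F₂.att ∪ {(∅, s₁)}
    sup := σ.F₂.sup ∪ {p | ∃ T ∈ σ.closureDefeated E₁, p = (T ∩ σ.F₂.args, s₁)}
    finite_args := σ.F₂.finite_args.union (Set.finite_singleton s₁)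
    att_sub := by
      rintro p (hp | rfl)
      · exact ⟨(σ.F₂.att_sub p hp).1.trans Set.subset_union_left, Or.inl (σ.F₂.att_sub p hp).2⟩
      · exact ⟨Set.empty_subset _, Or.inr rfl⟩
    sup_sub := by
      rintro p (hp | ⟨T, -, rfl⟩)
      · exact ⟨(σ.F₂.sup_sub p hp).1.trans Set.subset_union_left, Or.inl (σ.F₂.sup_sub p hp).2⟩
      · exact ⟨Set.inter_subset_right.trans Set.subset_union_left, Or.inr rfl⟩ }

open Classical in
/-- The type-2-modification of `F₂`: unless every support-incompatible set is closure-defeated, a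
new argument `s₂` (written `*₂`) is added; every support-incompatible set that is not
closure-defeated supports it, and attacks it together with `s₂` itself. -/
noncomputable def type2 (σ : SupportSplitting F) (E₁ : Set α) (s₂ : α) : BSAF α :=
  if σ.incompatible E₁ \ σ.closureDefeated E₁ = ∅ then σ.F₂ else
  { args := σ.F₂.args ∪ {s₂}
    att := σ.F₂.att ∪
      {p | ∃ T ∈ σ.incompatible E₁ \ σ.closureDefeated E₁, p = (T ∩ σ.F₂.args ∪ {s₂}, s₂)}
    sup := σ.F₂.sup ∪
      {p | ∃ T ∈ σ.incompatible E₁ \ σ.closureDefeated E₁, p = (T ∩ σ.F₂.args, s₂)}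
    finite_args := σ.F₂.finite_args.union (Set.finite_singleton s₂)
    att_sub := by
      rintro p (hp | ⟨T, -, rfl⟩)
      · exact ⟨(σ.F₂.att_sub p hp).1.trans Set.subset_union_left, Or.inl (σ.F₂.att_sub p hp).2⟩
      · exact ⟨Set.union_subset_union_left _ Set.inter_subset_right, Or.inr rfl⟩
    sup_sub := by
      rintro p (hp | ⟨T, -, rfl⟩)
      · exact ⟨(σ.F₂.sup_sub p hp).1.trans Set.subset_union_left, Or.inl (σ.F₂.sup_sub p hp).2⟩
      · exact ⟨Set.inter_subset_right.trans Set.subset_union_left, Or.inr rfl⟩ }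

/-- The S-reduct of `F₂` with respect to `E₁`. -/
noncomputable def sReduct (σ : SupportSplitting F) (E₁ : Set α) (s₁ s₂ : α) : BSAF α :=
  (σ.type1 E₁ s₁).union (σ.type2 E₁ s₂)

end SupportSplitting

/-! ### General splittings and the combined splitting procedure -/

/-- A splitting `(F₁, F₂, R₃, S₃)` of `F`. -/
structure Splitting {α : Type*} (F : BSAF α) where
  F₁ : BSAF α
  F₂ : BSAF α
  R₃ : Set (Set α × α)
  S₃ : Set (Set α × α)
  sub₁ : F₁.IsSub F
  sub₂ : F₂.IsSub F
  disj : F₁.args ∩ F₂.args = ∅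
  args_eq : F.args = F₁.args ∪ F₂.args
  att_eq : F.att = F₁.att ∪ F₂.att ∪ R₃
  sup_eq : F.sup = F₁.sup ∪ F₂.sup ∪ S₃
  R₃_sub : R₃ ⊆ {p | p ∈ F.att ∧ p.1 ∩ F₁.args ≠ ∅ ∧ p.1 ⊆ F.args ∧ p.2 ∈ F₂.args}
  S₃_sub : S₃ ⊆ {p | p ∈ F.sup ∧ p.1 ∩ F₂.args ≠ ∅ ∧ p.1 ⊆ F.args ∧ p.2 ∈ F₁.args}

namespace Splitting

variable {α : Type*} {F : BSAF α}

/-- `R̂₂`: the closed attacks of `F₂` that stay inside `F₂`. -/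
def hatR₂ (σ : Splitting F) : Set (Set α × α) :=
  {p | p ∈ F.closeLinks σ.F₂.att ∧ p.1 ∩ σ.F₁.args = ∅}

/-- `R̂₃`: the closed attacks from `R₃` and from `F₂` whose tail meets `F₁`. -/
def hatR₃ (σ : Splitting F) : Set (Set α × α) :=
  {p | p ∈ F.closeLinks σ.R₃ ∪ F.closeLinks σ.F₂.att ∧ p.1 ∩ σ.F₁.args ≠ ∅}

theorem closeLinks_F₂_sub (σ : Splitting F) :
    ∀ p ∈ F.closeLinks σ.F₂.att, p.1 ⊆ F.args ∧ p.2 ∈ σ.F₂.args :=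
  F.closeLinks_sub fun p hp =>
    ⟨(σ.F₂.att_sub p hp).1.trans σ.sub₂.1, (σ.F₂.att_sub p hp).2⟩

theorem closeLinks_R₃_sub (σ : Splitting F) :
    ∀ p ∈ F.closeLinks σ.R₃, p.1 ⊆ F.args ∧ p.2 ∈ σ.F₂.args :=
  F.closeLinks_sub fun _ hp => (σ.R₃_sub hp).2.2

theorem hatR₃_sub (σ : Splitting F) : ∀ p ∈ σ.hatR₃, p.1 ⊆ F.args ∧ p.2 ∈ σ.F₂.args := by
  rintro p ⟨hp | hp, -⟩
  · exact σ.closeLinks_R₃_sub p hp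
  · exact σ.closeLinks_F₂_sub p hp

/-- `F̂₂ = (A₂, R̂₂, S₂)`. -/
def hatF₂ (σ : Splitting F) : BSAF α where
  args := σ.F₂.args
  att := σ.hatR₂
  sup := σ.F₂.sup
  finite_args := σ.F₂.finite_args
  att_sub := by
    rintro p ⟨hp, hp'⟩
    refine ⟨fun x hx => ?_, (σ.closeLinks_F₂_sub p hp).2⟩
    have h1 := (σ.closeLinks_F₂_sub p hp).1 hx
    rw [σ.args_eq] at h1
    rcases h1 with h1 | h1
    · exact absurd (show x ∈ p.1 ∩ σ.F₁.args from ⟨hx, h1⟩) (by simp [hp'])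
    · exact h1
  sup_sub := σ.F₂.sup_sub

/-- The framework `(A, R₁ ∪ R̂₂ ∪ R̂₃, S₁ ∪ S₂)` that is attack-split as `(F₁, F̂₂, R̂₃)`. -/
def hatF (σ : Splitting F) : BSAF α where
  args := F.args
  att := σ.F₁.att ∪ σ.hatR₂ ∪ σ.hatR₃
  sup := σ.F₁.sup ∪ σ.F₂.sup
  finite_args := F.finite_args
  att_sub := by
    rintro p ((hp | hp) | hp)
    · exact F.att_sub p (σ.sub₁.2.1 hp)
    · have := σ.hatF₂.att_sub p hp
      exact ⟨this.1.trans σ.sub₂.1, σ.sub₂.1 this.2⟩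
    · exact ⟨(σ.hatR₃_sub p hp).1, σ.sub₂.1 (σ.hatR₃_sub p hp).2⟩
  sup_sub := by
    rintro p (hp | hp)
    · exact F.sup_sub p (σ.sub₁.2.2 hp)
    · exact F.sup_sub p (σ.sub₂.2.2 hp)

/-- The attack splitting `(F₁, F̂₂, R̂₃)`; its negative links are closed. -/
def attackSplitting (σ : Splitting F) : AttackSplitting σ.hatF where
  F₁ := σ.F₁
  F₂ := σ.hatF₂
  R₃ := σ.hatR₃
  sub₁ := ⟨σ.sub₁.1, fun _ hp => Or.inl (Or.inl hp), fun _ hp => Or.inl hp⟩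
  sub₂ := ⟨σ.sub₂.1, fun _ hp => Or.inl (Or.inr hp), fun _ hp => Or.inr hp⟩
  disj := σ.disj
  args_eq := σ.args_eq
  sup_eq := rfl
  att_eq := rfl
  R₃_sub := fun p hp => ⟨Or.inr hp, hp.2, (σ.hatR₃_sub p hp).1, (σ.hatR₃_sub p hp).2⟩

/-- `F₂^⋆`: the modification of the R-reduct of `F̂₂` with respect to `E₁`. -/
def starF₂ (σ : Splitting F) (E₁ : Set α) (s₀ : α) : BSAF α :=
  σ.attackSplitting.modification E₁ s₀

/-- The framework `(A₁ ∪ A₂^⋆, R₁ ∪ R₂^⋆, S)` that is support-split as `(F₁, F₂^⋆, S₃)`. -/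
def starF (σ : Splitting F) (E₁ : Set α) (s₀ : α) : BSAF α where
  args := σ.F₁.args ∪ (σ.starF₂ E₁ s₀).args
  att := σ.F₁.att ∪ (σ.starF₂ E₁ s₀).att
  sup := F.sup
  finite_args := σ.F₁.finite_args.union (σ.starF₂ E₁ s₀).finite_args
  att_sub := (σ.F₁.union (σ.starF₂ E₁ s₀)).att_sub
  sup_sub := by
    have hA : F.args ⊆ σ.F₁.args ∪ (σ.starF₂ E₁ s₀).args := by
      rw [σ.args_eq]
      exact Set.union_subset_union_right _ Set.subset_union_left
    exact fun p hp => ⟨(F.sup_sub p hp).1.trans hA, hA (F.sup_sub p hp).2⟩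

/-- The support splitting `(F₁, F₂^⋆, S₃)`. -/
def supportSplitting (σ : Splitting F) (E₁ : Set α) (s₀ : α) (h₀ : s₀ ∉ F.args) :
    SupportSplitting (σ.starF E₁ s₀) where
  F₁ := σ.F₁
  F₂ := σ.starF₂ E₁ s₀
  S₃ := σ.S₃
  sub₁ := ⟨Set.subset_union_left, Set.subset_union_left, σ.sub₁.2.2⟩
  sub₂ := ⟨Set.subset_union_right, Set.subset_union_right, σ.sub₂.2.2⟩
  disj := by
    ext x
    simp only [Set.mem_inter_iff, Set.mem_empty_iff_false, iff_false, not_and]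
    rintro hx (hx' | rfl)
    · exact absurd (show x ∈ σ.F₁.args ∩ σ.F₂.args from ⟨hx, hx'⟩) (by simp [σ.disj])
    · exact h₀ (σ.sub₁.1 hx)
  args_eq := rfl
  att_eq := rfl
  sup_eq := σ.sup_eq
  S₃_sub := by
    intro p hp
    obtain ⟨h1, h2, -, h4⟩ := σ.S₃_sub hp
    refine ⟨h1, ?_, ((σ.starF E₁ s₀).sup_sub p h1).1, h4⟩
    rw [← Set.nonempty_iff_ne_empty] at h2 ⊢
    exact h2.mono (Set.inter_subset_inter_right _ Set.subset_union_left)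

/-- `F₂^⊛`: the result of the combined splitting procedure, i.e. the S-reduct of `F₂^⋆` with respect
to `E₁`. The arguments `s₀`, `s₁`, `s₂` play the roles of `*₀`, `*₁`, `*₂`. -/
noncomputable def combined (σ : Splitting F) (E₁ : Set α) (s₀ s₁ s₂ : α) (h₀ : s₀ ∉ F.args) :
    BSAF α :=
  (σ.supportSplitting E₁ s₀ h₀).sReduct E₁ s₁ s₂

end Splitting

/-!
The proof compares two pairs of sets: `E₁ ∪ X` in `F`, with `E₁ ⊆ A₁` and `X ⊆ A₂`, and `Y` in
`F₂^⊛`, where `Y` is `X` or `X ∪ {*₂}`.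

Since no support leads from `A₁` to `A₂` and no attack leads from `A₂` to `A₁`, the framework `F`
restricted to `A₁` behaves like `F₁` (`Splitting.defends_iff_left`). For arguments of `A₂`, one may
replace every attack `(T, h)` by `(cl T, h)`, because only closed sets matter. A closed tail `U` is
then either contained in `A₂`, or attacked by `E₁` (and the attack is dropped), or satisfies
`U ∩ A₁ ⊆ E₁` (and the attack is projected to `A₂`), or is undecided (and the attack is projected and
blocked by the self-attacking `*₀`). So `E₁ ∪ X` and `Y` attack the same arguments of `A₂`
(`Splitting.Glued.attackedBy_iff`) and defend the same ones (`Splitting.Glued.defends_iff`). The only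
effect of `*₁` on defence is that a closed set containing it is attacked by every set; such a set
comes from one whose closure in `F` is attacked by `E₁` already. Because of the supports of `*₁` and
`*₂`, a closed conflict-free `Y` contains no projection of a support-incompatible tail, which makes
`E₁ ∪ X` closed under `S₃`; and `*₂` never takes part in an attack on another argument.

Hence admissibility and completeness pass between the two sides. A larger admissible (smaller
complete) set of `F` has the same trace on `A₁` by the choice of `E₁`, so its trace on `A₂`, with
`*₂` added where appropriate, contradicts the choice of `E₂`.
-/

namespace BSAF

variable {α : Type*}

/-! ### Closure and defence -/

theorem iterate_supp_mono (F : BSAF α) (E : Set α) : Monotone fun i => (F.supp)^[i] E := by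
  refine monotone_nat_of_le_succ fun i => ?_
  simp only [Function.iterate_succ_apply']
  exact Set.subset_union_left

theorem subset_cl (F : BSAF α) (E : Set α) : E ⊆ F.cl E := by
  intro x hx
  refine Set.mem_iUnion₂.2 ⟨1, le_refl 1, ?_⟩
  exact Or.inl hx

/-- The closure is closed under supports. This uses that tails are finite, so that a tail contained
in the union of the iterates is contained in one of them. -/
theorem mem_cl_of_sup (F : BSAF α) {E T : Set α} {h : α} (hT : (T, h) ∈ F.sup) (hTE : T ⊆ F.cl E) :
    h ∈ F.cl E := by
  have hfin : T.Finite := F.finite_args.subset (F.sup_sub _ hT).1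
  have hT' : (hfin.toFinset : Set α) ⊆ ⋃ i, (F.supp)^[i] E := fun x hx => by
    obtain ⟨i, -, hi⟩ := Set.mem_iUnion₂.1 (hTE (hfin.mem_toFinset.1 hx))
    exact Set.mem_iUnion.2 ⟨i, hi⟩
  obtain ⟨i, hi⟩ := Directed.exists_mem_subset_of_finset_subset_biUnion
    (F.iterate_supp_mono E).directed_le hT'
  rw [hfin.coe_toFinset] at hi
  refine Set.mem_iUnion₂.2 ⟨i + 1, Nat.le_add_left 1 i, ?_⟩
  rw [Function.iterate_succ_apply']
  exact Or.inr ⟨(F.sup_sub _ hT).2, T, hT, hi⟩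

theorem cl_subset_of_closed (F : BSAF α) {E K : Set α} (hE : E ⊆ K)
    (hK : ∀ T h, (T, h) ∈ F.sup → T ⊆ K → h ∈ K) : F.cl E ⊆ K := by
  refine Set.iUnion₂_subset fun i hi => ?_
  clear hi
  induction i with
  | zero => exact hE
  | succ n ih =>
    rw [Function.iterate_succ_apply']
    rintro x (hx | ⟨-, T, hT, hTE⟩)
    · exact ih hx
    · exact hK T x hT (hTE.trans ih)

theorem isClosed_iff (F : BSAF α) {E : Set α} :
    F.IsClosed E ↔ ∀ T h, (T, h) ∈ F.sup → T ⊆ E → h ∈ E := by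
  constructor
  · intro hE T h hT hTE
    have hE' : F.cl E = E := hE
    rw [← hE'] at hTE ⊢
    exact F.mem_cl_of_sup hT hTE
  · exact fun hE => (F.cl_subset_of_closed subset_rfl hE).antisymm (F.subset_cl E)

theorem isClosed_cl (F : BSAF α) (E : Set α) : F.IsClosed (F.cl E) :=
  F.isClosed_iff.2 fun _ _ => F.mem_cl_of_sup

theorem IsClosed.cl_subset {F : BSAF α} {E T : Set α} (hE : F.IsClosed E) (hT : T ⊆ E) :
    F.cl T ⊆ E :=
  F.cl_subset_of_closed hT (F.isClosed_iff.1 hE)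

theorem attackedBy_mono {R : Set (Set α × α)} {D E : Set α} (h : D ⊆ E) :
    attackedBy R D ⊆ attackedBy R E :=
  fun _ ⟨T, hT, hR⟩ => ⟨T, hT.trans h, hR⟩

theorem Defends.mono {F : BSAF α} {D E : Set α} {a : α} (h : F.Defends D a) (hDE : D ⊆ E) :
    F.Defends E a := by
  intro K hK hKc ha
  obtain ⟨x, hx, hxD⟩ := h K hK hKc ha
  exact ⟨x, hx, attackedBy_mono hDE hxD⟩

/-- Among the closed attackers of an argument, the closures of tails are the smallest ones. -/
theorem defends_iff_cl (F : BSAF α) {E : Set α} {a : α} :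
    F.Defends E a ↔ ∀ T, (T, a) ∈ F.att → F.Attacks E (F.cl T) := by
  constructor
  · exact fun h T hT => h _ (F.cl_subset (F.att_sub _ hT).1) (F.isClosed_cl T) ⟨T, F.subset_cl T, hT⟩
  · rintro h D - hD ⟨T, hTD, hT⟩
    obtain ⟨x, hx, hxE⟩ := h T hT
    exact ⟨x, hD.cl_subset hTD hx, hxE⟩

end BSAF

namespace Splitting

variable {α : Type*} {F : BSAF α} (σ : Splitting F)

/-! ### The left part of a splitting -/

theorem not_mem_right {x : α} (h₁ : x ∈ σ.F₁.args) : x ∉ σ.F₂.args := fun h₂ => by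
  have : x ∈ σ.F₁.args ∩ σ.F₂.args := ⟨h₁, h₂⟩
  rw [σ.disj] at this
  exact this

theorem mem_args_iff {x : α} : x ∈ F.args ↔ x ∈ σ.F₁.args ∨ x ∈ σ.F₂.args := by
  rw [σ.args_eq]
  rfl

theorem att_left {T : Set α} {x : α} (h : (T, x) ∈ F.att) (hx : x ∈ σ.F₁.args) :
    (T, x) ∈ σ.F₁.att := by
  rw [σ.att_eq] at h
  rcases h with (h | h) | h
  · exact h
  · exact absurd (σ.F₂.att_sub _ h).2 (σ.not_mem_right hx)
  · exact absurd (σ.R₃_sub h).2.2.2 (σ.not_mem_right hx)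

theorem sup_right {T : Set α} {x : α} (h : (T, x) ∈ F.sup) (hx : x ∈ σ.F₂.args) :
    (T, x) ∈ σ.F₂.sup := by
  rw [σ.sup_eq] at h
  rcases h with (h | h) | h
  · exact absurd hx (σ.not_mem_right (σ.F₁.sup_sub _ h).2)
  · exact h
  · exact absurd hx (σ.not_mem_right (σ.S₃_sub h).2.2.2)

/-- A support with tail in `A₁` is a support of `F₁`: this is where the exclusion of empty tails from
`S₂` matters. -/
theorem sup_left (hsup : ∀ h, ((∅ : Set α), h) ∉ σ.F₂.sup) {T : Set α} {x : α} (h : (T, x) ∈ F.sup)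
    (hT : T ⊆ σ.F₁.args) : (T, x) ∈ σ.F₁.sup := by
  rw [σ.sup_eq] at h
  rcases h with (h | h) | h
  · exact h
  · have : T = ∅ := Set.eq_empty_of_forall_notMem fun y hy =>
      σ.not_mem_right (hT hy) ((σ.F₂.sup_sub _ h).1 hy)
    subst this
    exact absurd h (hsup x)
  · refine absurd ?_ (σ.S₃_sub h).2.1
    exact Set.eq_empty_of_forall_notMem fun y hy => σ.not_mem_right (hT hy.1) hy.2

theorem cl_left (hsup : ∀ h, ((∅ : Set α), h) ∉ σ.F₂.sup) {T : Set α} (hT : T ⊆ σ.F₁.args) :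
    F.cl T = σ.F₁.cl T := by
  apply Set.Subset.antisymm
  · refine F.cl_subset_of_closed (σ.F₁.subset_cl T) fun U h hU hUT => ?_
    exact σ.F₁.mem_cl_of_sup (σ.sup_left hsup hU (hUT.trans (σ.F₁.cl_subset hT))) hUT
  · exact σ.F₁.cl_subset_of_closed (F.subset_cl T) fun U h hU => F.mem_cl_of_sup (σ.sub₁.2.2 hU)

theorem attackedBy_left {E : Set α} {x : α} (hx : x ∈ σ.F₁.args) :
    x ∈ attackedBy F.att E ↔ x ∈ attackedBy σ.F₁.att (E ∩ σ.F₁.args) := by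
  constructor
  · rintro ⟨T, hT, h⟩
    have h' := σ.att_left h hx
    exact ⟨T, Set.subset_inter hT (σ.F₁.att_sub _ h').1, h'⟩
  · rintro ⟨T, hT, h⟩
    exact ⟨T, hT.trans Set.inter_subset_left, σ.sub₁.2.1 h⟩

theorem defends_iff_left (hsup : ∀ h, ((∅ : Set α), h) ∉ σ.F₂.sup) {E : Set α} {a : α}
    (ha : a ∈ σ.F₁.args) : F.Defends E a ↔ σ.F₁.Defends (E ∩ σ.F₁.args) a := by
  rw [F.defends_iff_cl, σ.F₁.defends_iff_cl]
  have key : ∀ T, (T, a) ∈ σ.F₁.att →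
      (F.Attacks E (F.cl T) ↔ σ.F₁.Attacks (E ∩ σ.F₁.args) (σ.F₁.cl T)) := by
    intro T hT
    have hTA := (σ.F₁.att_sub _ hT).1
    rw [σ.cl_left hsup hTA]
    constructor
    · exact fun ⟨x, hx, hxE⟩ => ⟨x, hx, (σ.attackedBy_left (σ.F₁.cl_subset hTA hx)).1 hxE⟩
    · exact fun ⟨x, hx, hxE⟩ => ⟨x, hx, (σ.attackedBy_left (σ.F₁.cl_subset hTA hx)).2 hxE⟩
  exact ⟨fun h T hT => (key T hT).1 (h T (σ.sub₁.2.1 hT)),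
    fun h T hT => (key T (σ.att_left hT ha)).2 (h T (σ.att_left hT ha))⟩

theorem admissible_left (hsup : ∀ h, ((∅ : Set α), h) ∉ σ.F₂.sup) {E : Set α}
    (hE : F.Admissible E) : σ.F₁.Admissible (E ∩ σ.F₁.args) := by
  obtain ⟨⟨-, hcf⟩, hcl, hd⟩ := hE
  refine ⟨⟨Set.inter_subset_right, ?_⟩, ?_, fun a ha => (σ.defends_iff_left hsup ha.2).1 (hd a ha.1)⟩
  · rintro ⟨x, hx, hxE⟩
    exact hcf ⟨x, hx.1, (σ.attackedBy_left hx.2).2 hxE⟩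
  · rw [BSAF.isClosed_iff] at hcl ⊢
    exact fun T h hT hTE => ⟨hcl T h (σ.sub₁.2.2 hT) (hTE.trans Set.inter_subset_left),
      (σ.F₁.sup_sub _ hT).2⟩

theorem complete_left (hsup : ∀ h, ((∅ : Set α), h) ∉ σ.F₂.sup) {E : Set α}
    (hE : F.Complete E) : σ.F₁.Complete (E ∩ σ.F₁.args) :=
  ⟨σ.admissible_left hsup hE.1, fun a ha hd =>
    ⟨hE.2 a (σ.sub₁.1 ha) ((σ.defends_iff_left hsup ha).2 hd), ha⟩⟩

/-! ### Closed attacks -/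

theorem cl_mem_hat {T : Set α} {x : α} (h : (T, x) ∈ F.att) (hx : x ∈ σ.F₂.args) :
    (F.cl T, x) ∈ σ.hatR₂ ∨ (F.cl T, x) ∈ σ.hatR₃ := by
  rw [σ.att_eq] at h
  rcases h with (h | h) | h
  · exact absurd hx (σ.not_mem_right (σ.F₁.att_sub _ h).2)
  · by_cases hm : F.cl T ∩ σ.F₁.args = ∅
    · exact Or.inl ⟨⟨T, x, h, rfl⟩, hm⟩
    · exact Or.inr ⟨Or.inr ⟨T, x, h, rfl⟩, hm⟩
  · refine Or.inr ⟨Or.inl ⟨T, x, h, rfl⟩, fun h0 => (σ.R₃_sub h).2.1 ?_⟩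
    exact Set.subset_eq_empty (Set.inter_subset_inter_left _ (F.subset_cl T)) h0

theorem exists_att_of_hat {U : Set α} {x : α} (h : (U, x) ∈ σ.hatR₂ ∨ (U, x) ∈ σ.hatR₃) :
    x ∈ σ.F₂.args ∧ ∃ T, (T, x) ∈ F.att ∧ U = F.cl T := by
  have h' : (U, x) ∈ F.closeLinks σ.F₂.att ∨ (U, x) ∈ F.closeLinks σ.R₃ := by
    rcases h with ⟨h, -⟩ | ⟨h | h, -⟩
    exacts [Or.inl h, Or.inr h, Or.inl h]
  rcases h' with ⟨T, y, hT, he⟩ | ⟨T, y, hT, he⟩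
  · obtain ⟨rfl, rfl⟩ := Prod.mk.inj he
    exact ⟨(σ.F₂.att_sub _ hT).2, T, σ.sub₂.2.1 hT, rfl⟩
  · obtain ⟨rfl, rfl⟩ := Prod.mk.inj he
    exact ⟨(σ.R₃_sub hT).2.2.2, T, (σ.R₃_sub hT).1, rfl⟩

theorem attackedBy_of_hat {U E : Set α} {x : α} (h : (U, x) ∈ σ.hatR₂ ∨ (U, x) ∈ σ.hatR₃)
    (hU : U ⊆ E) : x ∈ attackedBy F.att E := by
  obtain ⟨-, T, hT, rfl⟩ := σ.exists_att_of_hat h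
  exact ⟨T, (F.subset_cl T).trans hU, hT⟩

theorem attackedBy_of_attackedBy_hatF {E : Set α} {x : α} (h : x ∈ attackedBy σ.hatF.att E) :
    x ∈ attackedBy F.att E := by
  obtain ⟨T, hT, (h | h) | h⟩ := h
  · exact ⟨T, hT, σ.sub₁.2.1 h⟩
  · exact σ.attackedBy_of_hat (Or.inl h) hT
  · exact σ.attackedBy_of_hat (Or.inr h) hT

/-- A defended argument of `A₂` is defended against every closed attack. -/
theorem attacks_of_defends {E U : Set α} {a : α} (hd : F.Defends E a)
    (h : (U, a) ∈ σ.hatR₂ ∨ (U, a) ∈ σ.hatR₃) : F.Attacks E U := by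
  obtain ⟨-, T, hT, rfl⟩ := σ.exists_att_of_hat h
  exact F.defends_iff_cl.1 hd T hT

/-! ### The components of `F₂^⊛` -/

variable (E₁ : Set α) (s₀ s₁ s₂ : α) (h₀ : s₀ ∉ F.args)

theorem mem_starF₂_att {V : Set α} {a : α} : (V, a) ∈ (σ.starF₂ E₁ s₀).att ↔
    (V, a) ∈ σ.hatR₂ ∨
    (∃ U, (U, a) ∈ σ.hatR₃ ∧ U ∩ attackedBy (σ.F₁.att ∪ σ.hatR₃) E₁ = ∅ ∧ U ∩ σ.F₁.args ⊆ E₁ ∧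
      V = U ∩ σ.F₂.args) ∨
    (V = {s₀} ∧ a = s₀) ∨
    ∃ U, (U, a) ∈ σ.hatR₃ ∧ U ∩ attackedBy σ.hatF.att E₁ = ∅ ∧ ¬ U ∩ σ.F₁.args ⊆ E₁ ∧
      V = U ∩ σ.F₂.args ∪ {s₀} := by
  constructor
  · rintro (((h | ⟨U, x, hU, h1, h2, he⟩) | h) | ⟨U, x, ⟨hU, h1, h2⟩, he⟩)
    · exact Or.inl h
    · obtain ⟨rfl, rfl⟩ := Prod.mk.inj he
      exact Or.inr (Or.inl ⟨U, hU, h1, h2, rfl⟩)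
    · exact Or.inr (Or.inr (Or.inl (Prod.mk.inj h)))
    · obtain ⟨rfl, rfl⟩ := Prod.mk.inj he
      exact Or.inr (Or.inr (Or.inr ⟨U, hU, h1, h2, rfl⟩))
  · rintro (h | ⟨U, hU, h1, h2, rfl⟩ | ⟨rfl, rfl⟩ | ⟨U, hU, h1, h2, rfl⟩)
    · exact Or.inl (Or.inl (Or.inl h))
    · exact Or.inl (Or.inl (Or.inr ⟨U, a, hU, h1, h2, rfl⟩))
    · exact Or.inl (Or.inr rfl)
    · exact Or.inr ⟨U, a, ⟨hU, h1, h2⟩, rfl⟩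

theorem starF₂_att_head {V : Set α} {a : α} (h : (V, a) ∈ (σ.starF₂ E₁ s₀).att) :
    a ∈ σ.F₂.args ∨ a = s₀ :=
  ((σ.starF₂ E₁ s₀).att_sub _ h).2

/-- The set `𝒯` of support-incompatible tails. -/
def incompat : Set (Set α) := (σ.supportSplitting E₁ s₀ h₀).incompatible E₁

/-- The set `𝒟` of closure-defeated tails. -/
def defeated : Set (Set α) := (σ.supportSplitting E₁ s₀ h₀).closureDefeated E₁

theorem mem_incompat {T : Set α} : T ∈ σ.incompat E₁ s₀ h₀ ↔
    ∃ h ∈ σ.F₁.args, (T, h) ∈ σ.S₃ ∧ T ∩ σ.F₁.args ⊆ E₁ ∧ h ∉ E₁ := by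
  constructor
  · exact fun h => h.2
  · rintro ⟨h, hh, hT, h1, h2⟩
    exact ⟨((σ.starF E₁ s₀).sup_sub _ (σ.S₃_sub hT).1).1, h, hh, hT, h1, h2⟩

theorem incompat_subset {T : Set α} (hT : T ∈ σ.incompat E₁ s₀ h₀) : T ⊆ F.args := by
  obtain ⟨h, -, hS, -⟩ := (σ.mem_incompat E₁ s₀ h₀).1 hT
  exact (σ.S₃_sub hS).2.2.1

/-- Since `*₀` lies outside `A`, adding it to `A₂` does not change the projection of a tail. -/
theorem inter_starF₂_args {T : Set α} (hT : T ∈ σ.incompat E₁ s₀ h₀) :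
    T ∩ (σ.supportSplitting E₁ s₀ h₀).F₂.args = T ∩ σ.F₂.args := by
  ext x
  constructor
  · rintro ⟨hx, h | h⟩
    · exact ⟨hx, h⟩
    · exact absurd (h ▸ σ.incompat_subset E₁ s₀ h₀ hT hx) h₀
  · exact fun hx => ⟨hx.1, Or.inl hx.2⟩

theorem starF_cl (T : Set α) : (σ.starF E₁ s₀).cl T = F.cl T :=
  ((σ.starF E₁ s₀).cl_subset_of_closed (F.subset_cl T) fun _ _ => F.mem_cl_of_sup).antisymm
    (F.cl_subset_of_closed ((σ.starF E₁ s₀).subset_cl T) fun _ _ =>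
      (σ.starF E₁ s₀).mem_cl_of_sup)

theorem mem_combined_args {x : α} : x ∈ (σ.combined E₁ s₀ s₁ s₂ h₀).args ↔
    x ∈ σ.F₂.args ∨ x = s₀ ∨ (x = s₁ ∧ (σ.defeated E₁ s₀ h₀).Nonempty) ∨
      (x = s₂ ∧ (σ.incompat E₁ s₀ h₀ \ σ.defeated E₁ s₀ h₀).Nonempty) := by
  have hA : (σ.supportSplitting E₁ s₀ h₀).F₂.args = σ.F₂.args ∪ {s₀} := rfl
  simp only [combined, SupportSplitting.sReduct, BSAF.union, SupportSplitting.type1,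
    SupportSplitting.type2, Set.nonempty_iff_ne_empty, incompat, defeated]
  split_ifs <;> simp_all <;> tauto

theorem mem_combined_att {V : Set α} {a : α} : (V, a) ∈ (σ.combined E₁ s₀ s₁ s₂ h₀).att ↔
    (V, a) ∈ (σ.starF₂ E₁ s₀).att ∨ (V = ∅ ∧ a = s₁ ∧ (σ.defeated E₁ s₀ h₀).Nonempty) ∨
      ∃ T ∈ σ.incompat E₁ s₀ h₀ \ σ.defeated E₁ s₀ h₀, V = T ∩ σ.F₂.args ∪ {s₂} ∧ a = s₂ := by
  have hA : (σ.supportSplitting E₁ s₀ h₀).F₂.att = (σ.starF₂ E₁ s₀).att := rfl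
  have h1 : (V, a) ∈ ((σ.supportSplitting E₁ s₀ h₀).type1 E₁ s₁).att ↔
      (V, a) ∈ (σ.starF₂ E₁ s₀).att ∨ (V = ∅ ∧ a = s₁ ∧ (σ.defeated E₁ s₀ h₀).Nonempty) := by
    simp only [SupportSplitting.type1, Set.nonempty_iff_ne_empty, defeated]
    split_ifs <;> simp_all [or_comm]
  have h2 : (V, a) ∈ ((σ.supportSplitting E₁ s₀ h₀).type2 E₁ s₂).att ↔
      (V, a) ∈ (σ.starF₂ E₁ s₀).att ∨ ∃ T ∈ σ.incompat E₁ s₀ h₀ \ σ.defeated E₁ s₀ h₀,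
        V = T ∩ σ.F₂.args ∪ {s₂} ∧ a = s₂ := by
    unfold SupportSplitting.type2
    split_ifs with hI
    · rw [hA]
      change _ ↔ _ ∨ ∃ T ∈ (σ.supportSplitting E₁ s₀ h₀).incompatible E₁ \
        (σ.supportSplitting E₁ s₀ h₀).closureDefeated E₁, _
      rw [hI]
      simp
    · refine or_congr Iff.rfl (exists_congr fun T => and_congr_right fun hT => ?_)
      rw [Prod.mk.injEq, σ.inter_starF₂_args E₁ s₀ h₀ hT.1]
  change _ ∨ _ ↔ _
  rw [h1, h2]
  exact or_or_distrib_left.symm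

theorem mem_combined_sup {V : Set α} {a : α} : (V, a) ∈ (σ.combined E₁ s₀ s₁ s₂ h₀).sup ↔
    (V, a) ∈ σ.F₂.sup ∨ (∃ T ∈ σ.defeated E₁ s₀ h₀, V = T ∩ σ.F₂.args ∧ a = s₁) ∨
      ∃ T ∈ σ.incompat E₁ s₀ h₀ \ σ.defeated E₁ s₀ h₀, V = T ∩ σ.F₂.args ∧ a = s₂ := by
  have hA : (σ.supportSplitting E₁ s₀ h₀).F₂.sup = σ.F₂.sup := rfl
  have h1 : (V, a) ∈ ((σ.supportSplitting E₁ s₀ h₀).type1 E₁ s₁).sup ↔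
      (V, a) ∈ σ.F₂.sup ∨ ∃ T ∈ σ.defeated E₁ s₀ h₀, V = T ∩ σ.F₂.args ∧ a = s₁ := by
    unfold SupportSplitting.type1
    split_ifs with hI
    · rw [hA]
      change _ ↔ _ ∨ ∃ T ∈ (σ.supportSplitting E₁ s₀ h₀).closureDefeated E₁, _
      rw [hI]
      simp
    · refine or_congr Iff.rfl (exists_congr fun T => and_congr_right fun hT => ?_)
      rw [Prod.mk.injEq, σ.inter_starF₂_args E₁ s₀ h₀ hT.1]
  have h2 : (V, a) ∈ ((σ.supportSplitting E₁ s₀ h₀).type2 E₁ s₂).sup ↔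
      (V, a) ∈ σ.F₂.sup ∨ ∃ T ∈ σ.incompat E₁ s₀ h₀ \ σ.defeated E₁ s₀ h₀,
        V = T ∩ σ.F₂.args ∧ a = s₂ := by
    unfold SupportSplitting.type2
    split_ifs with hI
    · rw [hA]
      change _ ↔ _ ∨ ∃ T ∈ (σ.supportSplitting E₁ s₀ h₀).incompatible E₁ \
        (σ.supportSplitting E₁ s₀ h₀).closureDefeated E₁, _
      rw [hI]
      simp
    · refine or_congr Iff.rfl (exists_congr fun T => and_congr_right fun hT => ?_)
      rw [Prod.mk.injEq, σ.inter_starF₂_args E₁ s₀ h₀ hT.1]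
  change _ ∨ _ ↔ _
  rw [h1, h2]
  exact or_or_distrib_left.symm

/-- The closure in `F` of a closure-defeated tail is attacked by `E₁` in `F`. -/
theorem attacks_cl_of_defeated (hE₁ : E₁ ⊆ σ.F₁.args) {T : Set α}
    (hT : T ∈ σ.defeated E₁ s₀ h₀) : T ⊆ σ.F₂.args ∧ F.Attacks E₁ (F.cl T) := by
  obtain ⟨hI, hT1, hne⟩ := hT
  refine ⟨fun x hx => ?_, ?_⟩
  · rcases σ.mem_args_iff.1 (σ.incompat_subset E₁ s₀ h₀ hI hx) with h | h
    · exact absurd (show x ∈ T ∩ σ.F₁.args from ⟨hx, h⟩) (hT1 ▸ Set.notMem_empty x)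
    · exact h
  · obtain ⟨x, hx, V, hV, hatt⟩ := Set.nonempty_iff_ne_empty.2 hne
    rw [starF_cl] at hx
    have hs₀ : s₀ ∉ V := fun h => h₀ (σ.sub₁.1 (hE₁ (hV h)))
    refine ⟨x, hx, ?_⟩
    rcases hatt with hatt | hatt
    · exact ⟨V, hV, σ.sub₁.2.1 hatt⟩
    rcases (σ.mem_starF₂_att E₁ s₀).1 hatt with h | ⟨U, hU, -, h1, rfl⟩ | ⟨rfl, -⟩ | ⟨U, -, -, -, rfl⟩
    · exact σ.attackedBy_of_hat (Or.inl h) hV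
    · refine σ.attackedBy_of_hat (Or.inr hU) fun y hy => ?_
      rcases σ.mem_args_iff.1 ((σ.hatR₃_sub _ hU).1 hy) with h | h
      · exact h1 ⟨hy, h⟩
      · exact hV ⟨hy, h⟩
    · exact absurd rfl hs₀
    · exact absurd (Or.inr rfl) hs₀

/-! ### Comparison of `F` and `F₂^⊛` -/

/-- `E₁ ∪ X` is closed in `F`, the part `E₁` is conflict-free and does not attack `X` by closed
attacks, and `Y` arises from `X` by possibly adding `*₂`. -/
structure Glued (X Y : Set α) : Prop where
  left : E₁ ⊆ σ.F₁.args
  right : X ⊆ σ.F₂.args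
  conflictFree : ∀ x ∈ E₁, x ∉ attackedBy σ.F₁.att E₁
  closed : F.IsClosed (E₁ ∪ X)
  not_attacked : ∀ x ∈ X, x ∉ attackedBy σ.hatR₃ E₁
  subset : X ⊆ Y
  subset_union : Y ⊆ X ∪ {s₂}

variable {σ E₁ s₀ s₁ s₂ h₀}

namespace Glued

variable {X Y : Set α}

theorem inter_left (g : σ.Glued E₁ s₂ X Y) : (E₁ ∪ X) ∩ σ.F₁.args = E₁ := by
  ext x
  constructor
  · rintro ⟨h | h, hx⟩
    · exact h
    · exact absurd (g.right h) (σ.not_mem_right hx)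
  · exact fun h => ⟨Or.inl h, g.left h⟩

theorem mem_of_right (g : σ.Glued E₁ s₂ X Y) {x : α} (h : x ∈ E₁ ∪ X) (hx : x ∈ σ.F₂.args) :
    x ∈ X := by
  rcases h with h | h
  · exact absurd hx (σ.not_mem_right (g.left h))
  · exact h

theorem mem_iff (g : σ.Glued E₁ s₂ X Y) {x : α} (hx : x ≠ s₂) : x ∈ Y ↔ x ∈ X :=
  ⟨fun h => (g.subset_union h).resolve_right hx, fun h => g.subset h⟩

theorem mem_right_iff (g : σ.Glued E₁ s₂ X Y) (h₂ : s₂ ∉ F.args) {x : α} (hx : x ∈ σ.F₂.args) :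
    x ∈ Y ↔ x ∈ X :=
  g.mem_iff fun h => h₂ (h ▸ σ.sub₂.1 hx)

/-- No support-incompatible tail projects into `Y`, because `E₁ ∪ X` is closed. -/
theorem not_subset (g : σ.Glued E₁ s₂ X Y) (h₂ : s₂ ∉ F.args) {T : Set α}
    (hT : T ∈ σ.incompat E₁ s₀ h₀) : ¬ T ∩ σ.F₂.args ⊆ Y := by
  intro hTY
  obtain ⟨h, hh, hS, h1, h2⟩ := (σ.mem_incompat E₁ s₀ h₀).1 hT
  have hTE : T ⊆ E₁ ∪ X := fun x hx => by
    rcases σ.mem_args_iff.1 (σ.incompat_subset E₁ s₀ h₀ hT hx) with h | h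
    · exact Or.inl (h1 ⟨hx, h⟩)
    · exact Or.inr ((g.mem_right_iff h₂ h).1 (hTY ⟨hx, h⟩))
  rcases F.isClosed_iff.1 g.closed T h (σ.S₃_sub hS).1 hTE with h | h
  · exact h2 h
  · exact σ.not_mem_right hh (g.right h)

theorem not_mem_zero (g : σ.Glued E₁ s₂ X Y) (h₀ : s₀ ∉ F.args) (h₀₂ : s₀ ≠ s₂) : s₀ ∉ Y :=
  fun h => h₀ (σ.sub₂.1 (g.right ((g.mem_iff h₀₂).1 h)))

/-- `E₁ ∪ X` and `Y` attack the same arguments of `A₂`. -/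
theorem attackedBy_iff (g : σ.Glued E₁ s₂ X Y) (h₁ : s₁ ∉ F.args) (h₂ : s₂ ∉ F.args)
    (h₀₂ : s₀ ≠ s₂) {x : α} (hx : x ∈ σ.F₂.args) :
    x ∈ attackedBy F.att (E₁ ∪ X) ↔ x ∈ attackedBy (σ.combined E₁ s₀ s₁ s₂ h₀).att Y := by
  constructor
  · rintro ⟨T, hT, hatt⟩
    have hU : F.cl T ⊆ E₁ ∪ X := g.closed.cl_subset hT
    have hUX : F.cl T ∩ σ.F₂.args ⊆ Y := fun y hy => g.subset (g.mem_of_right (hU hy.1) hy.2)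
    suffices h : ∃ V ⊆ Y, (V, x) ∈ (σ.starF₂ E₁ s₀).att by
      obtain ⟨V, hV, h⟩ := h
      exact ⟨V, hV, (σ.mem_combined_att E₁ s₀ s₁ s₂ h₀).2 (Or.inl h)⟩
    rcases σ.cl_mem_hat hatt hx with h | h
    · exact ⟨F.cl T, fun y hy => hUX ⟨hy, (σ.hatF₂.att_sub _ h).1 hy⟩,
        (σ.mem_starF₂_att E₁ s₀).2 (Or.inl h)⟩
    · refine ⟨F.cl T ∩ σ.F₂.args, hUX,
        (σ.mem_starF₂_att E₁ s₀).2 (Or.inr (Or.inl ⟨_, h, ?_, ?_, rfl⟩))⟩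
      · refine Set.eq_empty_of_forall_notMem ?_
        rintro y ⟨hy, W, hW, hWy | hWy⟩
        · have hy1 := (σ.F₁.att_sub _ hWy).2
          have : y ∈ (E₁ ∪ X) ∩ σ.F₁.args := ⟨hU hy, hy1⟩
          rw [g.inter_left] at this
          exact g.conflictFree y this ⟨W, hW, hWy⟩
        · exact g.not_attacked y (g.mem_of_right (hU hy) (σ.hatR₃_sub _ hWy).2) ⟨W, hW, hWy⟩
      · exact fun y hy => g.inter_left ▸ (⟨hU hy.1, hy.2⟩ : y ∈ (E₁ ∪ X) ∩ σ.F₁.args)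
  · rintro ⟨V, hV, hatt⟩
    have hs₀ := g.not_mem_zero h₀ h₀₂
    rcases (σ.mem_combined_att E₁ s₀ s₁ s₂ h₀).1 hatt with h | ⟨-, rfl, -⟩ | ⟨T, -, -, rfl⟩
    · rcases (σ.mem_starF₂_att E₁ s₀).1 h with h | ⟨U, hU, -, h1, rfl⟩ | ⟨rfl, -⟩ | ⟨U, -, -, -, rfl⟩
      · refine σ.attackedBy_of_hat (Or.inl h) fun y hy => Or.inr ?_
        exact (g.mem_right_iff h₂ ((σ.hatF₂.att_sub _ h).1 hy)).1 (hV hy)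
      · refine σ.attackedBy_of_hat (Or.inr hU) fun y hy => ?_
        rcases σ.mem_args_iff.1 ((σ.hatR₃_sub _ hU).1 hy) with h | h
        · exact Or.inl (h1 ⟨hy, h⟩)
        · exact Or.inr ((g.mem_right_iff h₂ h).1 (hV ⟨hy, h⟩))
      · exact absurd (hV rfl) hs₀
      · exact absurd (hV (Or.inr rfl)) hs₀
    · exact absurd (σ.sub₂.1 hx) h₁
    · exact absurd (σ.sub₂.1 hx) h₂

theorem not_attackedBy_zero (g : σ.Glued E₁ s₂ X Y) (h₀₁ : s₀ ≠ s₁) (h₀₂ : s₀ ≠ s₂) :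
    s₀ ∉ attackedBy (σ.combined E₁ s₀ s₁ s₂ h₀).att Y := by
  rintro ⟨V, hV, hatt⟩
  have hs₀ := g.not_mem_zero h₀ h₀₂
  have hs : s₀ ∉ σ.F₂.args := fun h => h₀ (σ.sub₂.1 h)
  rcases (σ.mem_combined_att E₁ s₀ s₁ s₂ h₀).1 hatt with h | ⟨-, h, -⟩ | ⟨T, -, -, h⟩
  · rcases (σ.mem_starF₂_att E₁ s₀).1 h with h | ⟨U, hU, -⟩ | ⟨rfl, -⟩ | ⟨U, hU, -⟩
    · exact hs (σ.exists_att_of_hat (Or.inl h)).1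
    · exact hs (σ.exists_att_of_hat (Or.inr hU)).1
    · exact hs₀ (hV rfl)
    · exact hs (σ.exists_att_of_hat (Or.inr hU)).1
  · exact h₀₁ h
  · exact h₀₂ h

theorem not_attackedBy_two (g : σ.Glued E₁ s₂ X Y) (h₂ : s₂ ∉ F.args) (h₀₂ : s₀ ≠ s₂)
    (h₁₂ : s₁ ≠ s₂) : s₂ ∉ attackedBy (σ.combined E₁ s₀ s₁ s₂ h₀).att Y := by
  rintro ⟨V, hV, hatt⟩
  rcases (σ.mem_combined_att E₁ s₀ s₁ s₂ h₀).1 hatt with h | ⟨-, h, -⟩ | ⟨T, hT, rfl, -⟩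
  · rcases σ.starF₂_att_head E₁ s₀ h with h | h
    · exact h₂ (σ.sub₂.1 h)
    · exact h₀₂ h.symm
  · exact h₁₂ h.symm
  · exact g.not_subset h₂ hT.1 (Set.subset_union_left.trans hV)

/-- `*₂` contributes nothing to the attacks of `Y`. -/
theorem attackedBy_subset (g : σ.Glued E₁ s₂ X Y) (h₁ : s₁ ∉ F.args) (h₂ : s₂ ∉ F.args)
    (h₀₁ : s₀ ≠ s₁) (h₀₂ : s₀ ≠ s₂) (h₁₂ : s₁ ≠ s₂) :
    attackedBy (σ.combined E₁ s₀ s₁ s₂ h₀).att Y ⊆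
      attackedBy (σ.combined E₁ s₀ s₁ s₂ h₀).att X := by
  have g₀ : σ.Glued E₁ s₂ X X :=
    { g with subset := subset_rfl, subset_union := Set.subset_union_left }
  rintro x hxY
  obtain ⟨V, hV, hatt⟩ := hxY
  rcases (σ.mem_combined_att E₁ s₀ s₁ s₂ h₀).1 hatt with h | ⟨rfl, -⟩ | ⟨-, -, -, rfl⟩
  · rcases σ.starF₂_att_head E₁ s₀ h with h | rfl
    · exact (g₀.attackedBy_iff h₁ h₂ h₀₂ h).1 ((g.attackedBy_iff h₁ h₂ h₀₂ h).2 ⟨V, hV, hatt⟩)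
    · exact absurd ⟨V, hV, hatt⟩ (g.not_attackedBy_zero h₀₁ h₀₂)
  · exact ⟨∅, Set.empty_subset _, hatt⟩
  · exact absurd ⟨V, hV, hatt⟩ (g.not_attackedBy_two h₂ h₀₂ h₁₂)

/-- `E₁ ∪ X` and `Y` defend the same arguments of `A₂`. -/
theorem defends_iff (g : σ.Glued E₁ s₂ X Y) (h₁ : s₁ ∉ F.args) (h₂ : s₂ ∉ F.args)
    (h₀₁ : s₀ ≠ s₁) (h₀₂ : s₀ ≠ s₂) (h₁₂ : s₁ ≠ s₂) (hcf : ¬ F.Attacks (E₁ ∪ X) (E₁ ∪ X))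
    {a : α} (ha : a ∈ σ.F₂.args) :
    F.Defends (E₁ ∪ X) a ↔ (σ.combined E₁ s₀ s₁ s₂ h₀).Defends Y a := by
  constructor
  · intro hd
    rw [BSAF.defends_iff_cl]
    intro V hV
    have hVcl := (σ.combined E₁ s₀ s₁ s₂ h₀).subset_cl V
    rcases (σ.mem_combined_att E₁ s₀ s₁ s₂ h₀).1 hV with h | ⟨-, rfl, -⟩ | ⟨T, -, -, rfl⟩
    · rcases (σ.mem_starF₂_att E₁ s₀).1 h with h | ⟨U, hU, -, h1, rfl⟩ | ⟨-, rfl⟩ |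
          ⟨U, hU, h0, -, rfl⟩
      · obtain ⟨x, hx, hxE⟩ := σ.attacks_of_defends hd (Or.inl h)
        exact ⟨x, hVcl hx, (g.attackedBy_iff h₁ h₂ h₀₂ ((σ.hatF₂.att_sub _ h).1 hx)).1 hxE⟩
      · obtain ⟨x, hx, hxE⟩ := σ.attacks_of_defends hd (Or.inr hU)
        rcases σ.mem_args_iff.1 ((σ.hatR₃_sub _ hU).1 hx) with hx' | hx'
        · exact absurd ⟨x, Or.inl (h1 ⟨hx, hx'⟩), hxE⟩ hcf
        · exact ⟨x, hVcl ⟨hx, hx'⟩, (g.attackedBy_iff h₁ h₂ h₀₂ hx').1 hxE⟩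
      · exact absurd (σ.sub₂.1 ha) h₀
      · obtain ⟨x, hx, hxE⟩ := σ.attacks_of_defends hd (Or.inr hU)
        rcases σ.mem_args_iff.1 ((σ.hatR₃_sub _ hU).1 hx) with hx' | hx'
        · rw [σ.attackedBy_left hx', g.inter_left] at hxE
          obtain ⟨W, hW, hWx⟩ := hxE
          have : x ∈ U ∩ attackedBy σ.hatF.att E₁ := ⟨hx, W, hW, Or.inl (Or.inl hWx)⟩
          rw [h0] at this
          exact absurd this (Set.notMem_empty x)
        · exact ⟨x, hVcl (Or.inl ⟨hx, hx'⟩), (g.attackedBy_iff h₁ h₂ h₀₂ hx').1 hxE⟩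
    · exact absurd (σ.sub₂.1 ha) h₁
    · exact absurd (σ.sub₂.1 ha) h₂
  · intro hd
    rw [BSAF.defends_iff_cl] at hd ⊢
    intro T hT
    -- The closed attack from `U = cl T` survives in `F₂^⊛` as one from `U ∩ A₂`, with or without
    -- `*₀`, unless `E₁` attacks `U`.
    set U := F.cl T with hUdef
    by_contra hno
    have hhat := σ.cl_mem_hat hT ha
    rw [← hUdef] at hhat
    have hE₁no : ∀ x ∈ U, x ∉ attackedBy F.att E₁ := fun x hx hxE =>
      hno ⟨x, hx, BSAF.attackedBy_mono Set.subset_union_left hxE⟩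
    obtain ⟨V, hV, hVU⟩ : ∃ V, (V, a) ∈ (σ.starF₂ E₁ s₀).att ∧ V ⊆ U ∩ σ.F₂.args ∪ {s₀} := by
      rcases hhat with h | h
      · exact ⟨U, (σ.mem_starF₂_att E₁ s₀).2 (Or.inl h),
          fun x hx => Or.inl ⟨hx, (σ.hatF₂.att_sub _ h).1 hx⟩⟩
      · by_cases hU : U ∩ σ.F₁.args ⊆ E₁
        · refine ⟨_, (σ.mem_starF₂_att E₁ s₀).2 (Or.inr (Or.inl ⟨U, h, ?_, hU, rfl⟩)),
            Set.subset_union_left⟩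
          refine Set.eq_empty_of_forall_notMem ?_
          rintro x ⟨hx, W, hW, hWx | hWx⟩
          · exact hE₁no x hx ⟨W, hW, σ.sub₁.2.1 hWx⟩
          · exact hE₁no x hx (σ.attackedBy_of_hat (Or.inr hWx) hW)
        · refine ⟨_, (σ.mem_starF₂_att E₁ s₀).2 (Or.inr (Or.inr (Or.inr ⟨U, h, ?_, hU, rfl⟩))),
            subset_rfl⟩
          exact Set.eq_empty_of_forall_notMem fun x hx =>
            hE₁no x hx.1 (σ.attackedBy_of_attackedBy_hatF hx.2)
    obtain ⟨x, hx, hxY⟩ := hd V ((σ.mem_combined_att E₁ s₀ s₁ s₂ h₀).2 (Or.inl hV))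
    have htail : ∀ W : Set α, W ⊆ σ.F₂.args → W ⊆ U ∩ σ.F₂.args ∪ {s₀} ∪ {s₂} → W ⊆ U := by
      intro W hW hWK y hy
      rcases hWK hy with (h | h) | h
      · exact h.1
      · exact absurd (h ▸ σ.sub₂.1 (hW hy)) h₀
      · exact absurd (h ▸ σ.sub₂.1 (hW hy)) h₂
    have hK : (σ.combined E₁ s₀ s₁ s₂ h₀).cl V ⊆ U ∩ σ.F₂.args ∪ {s₀} ∪ {s₂} := by
      refine BSAF.cl_subset_of_closed _ (hVU.trans Set.subset_union_left) fun W h hWh hWK => ?_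
      rcases (σ.mem_combined_sup E₁ s₀ s₁ s₂ h₀).1 hWh with h' | ⟨T', hT', rfl, rfl⟩ | ⟨T', -, -, rfl⟩
      · have hWU := htail W (σ.F₂.sup_sub _ h').1 hWK
        exact Or.inl (Or.inl ⟨F.mem_cl_of_sup (σ.sub₂.2.2 h') hWU, (σ.F₂.sup_sub _ h').2⟩)
      -- A support of `*₁` cannot occur, as `E₁` would attack `U`.
      · obtain ⟨hT'2, y, hy, hyE⟩ := σ.attacks_cl_of_defeated E₁ s₀ h₀ g.left hT'
        rw [Set.inter_eq_self_of_subset_left hT'2] at hWK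
        exact absurd hyE (hE₁no y ((F.isClosed_cl T).cl_subset (htail T' hT'2 hWK) hy))
      · exact Or.inr rfl
    rcases hK hx with (h | h) | h
    · exact hno ⟨x, h.1, (g.attackedBy_iff h₁ h₂ h₀₂ h.2).2 hxY⟩
    · exact g.not_attackedBy_zero h₀₁ h₀₂ (h ▸ hxY)
    · exact g.not_attackedBy_two h₂ h₀₂ h₁₂ (h ▸ hxY)

/-! ### Transfer of admissibility and completeness -/

theorem isClosed_right (g : σ.Glued E₁ s₂ X Y) (h₂ : s₂ ∉ F.args) :
    (σ.combined E₁ s₀ s₁ s₂ h₀).IsClosed Y := by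
  rw [BSAF.isClosed_iff]
  intro V a hV hVY
  rcases (σ.mem_combined_sup E₁ s₀ s₁ s₂ h₀).1 hV with h | ⟨T, hT, rfl, -⟩ | ⟨T, hT, rfl, -⟩
  · have hs := σ.F₂.sup_sub _ h
    refine g.subset (g.mem_of_right (F.isClosed_iff.1 g.closed V a (σ.sub₂.2.2 h) ?_) hs.2)
    exact fun x hx => Or.inr ((g.mem_right_iff h₂ (hs.1 hx)).1 (hVY hx))
  · exact absurd hVY (g.not_subset h₂ hT.1)
  · exact absurd hVY (g.not_subset h₂ hT.1)

/-- An admissible set `E₁ ∪ X` of `F` yields an admissible set of `F₂^⊛`, to which `*₂` may be added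
if it is defended. -/
theorem admissible_right (g : σ.Glued E₁ s₂ X Y) (h₁ : s₁ ∉ F.args) (h₂ : s₂ ∉ F.args)
    (h₀₁ : s₀ ≠ s₁) (h₀₂ : s₀ ≠ s₂) (h₁₂ : s₁ ≠ s₂) (hE : F.Admissible (E₁ ∪ X))
    (hs₂ : s₂ ∈ Y → s₂ ∈ (σ.combined E₁ s₀ s₁ s₂ h₀).args ∧
      (σ.combined E₁ s₀ s₁ s₂ h₀).Defends Y s₂) :
    (σ.combined E₁ s₀ s₁ s₂ h₀).Admissible Y := by
  refine ⟨⟨fun x hx => ?_, ?_⟩, g.isClosed_right h₂, fun x hx => ?_⟩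
  · rcases g.subset_union hx with h | rfl
    · exact (σ.mem_combined_args E₁ s₀ s₁ s₂ h₀).2 (Or.inl (g.right h))
    · exact (hs₂ hx).1
  · rintro ⟨x, hx, hxY⟩
    rcases g.subset_union hx with h | rfl
    · exact hE.1.2 ⟨x, Or.inr h, (g.attackedBy_iff h₁ h₂ h₀₂ (g.right h)).2 hxY⟩
    · exact g.not_attackedBy_two h₂ h₀₂ h₁₂ hxY
  · rcases g.subset_union hx with h | rfl
    · exact (g.defends_iff h₁ h₂ h₀₁ h₀₂ h₁₂ hE.1.2 (g.right h)).1 (hE.2.2 x (Or.inr h))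
    · exact (hs₂ hx).2

/-- An admissible set `E₁` of `F₁` and an admissible set `Y` of `F₂^⊛` glue to an admissible set of
`F`. -/
theorem admissible (g : σ.Glued E₁ s₂ X Y) (hsup : ∀ h, ((∅ : Set α), h) ∉ σ.F₂.sup)
    (h₁ : s₁ ∉ F.args) (h₂ : s₂ ∉ F.args) (h₀₁ : s₀ ≠ s₁) (h₀₂ : s₀ ≠ s₂) (h₁₂ : s₁ ≠ s₂)
    (hE₁ : σ.F₁.Admissible E₁) (hY : (σ.combined E₁ s₀ s₁ s₂ h₀).Admissible Y) :
    F.Admissible (E₁ ∪ X) := by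
  have hcf : ¬ F.Attacks (E₁ ∪ X) (E₁ ∪ X) := by
    rintro ⟨x, hx | hx, hxE⟩
    · rw [σ.attackedBy_left (g.left hx), g.inter_left] at hxE
      exact g.conflictFree x hx hxE
    · exact hY.1.2 ⟨x, g.subset hx, (g.attackedBy_iff h₁ h₂ h₀₂ (g.right hx)).1 hxE⟩
  refine ⟨⟨Set.union_subset (g.left.trans σ.sub₁.1) (g.right.trans σ.sub₂.1), hcf⟩, g.closed, ?_⟩
  rintro a (ha | ha)
  · rw [σ.defends_iff_left hsup (g.left ha), g.inter_left]
    exact hE₁.2.2 a ha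
  · exact (g.defends_iff h₁ h₂ h₀₁ h₀₂ h₁₂ hcf (g.right ha)).2 (hY.2.2 a (g.subset ha))

theorem complete (g : σ.Glued E₁ s₂ X Y) (hsup : ∀ h, ((∅ : Set α), h) ∉ σ.F₂.sup)
    (h₁ : s₁ ∉ F.args) (h₂ : s₂ ∉ F.args) (h₀₁ : s₀ ≠ s₁) (h₀₂ : s₀ ≠ s₂) (h₁₂ : s₁ ≠ s₂)
    (hE₁ : σ.F₁.Complete E₁) (hY : (σ.combined E₁ s₀ s₁ s₂ h₀).Complete Y) :
    F.Complete (E₁ ∪ X) := by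
  have hadm := g.admissible hsup h₁ h₂ h₀₁ h₀₂ h₁₂ hE₁.1 hY.1
  refine ⟨hadm, fun a ha hd => ?_⟩
  rcases σ.mem_args_iff.1 ha with ha | ha
  · rw [σ.defends_iff_left hsup ha, g.inter_left] at hd
    exact Or.inl (hE₁.2 a ha hd)
  · have hd' := (g.defends_iff (h₀ := h₀) h₁ h₂ h₀₁ h₀₂ h₁₂ hadm.1.2 ha).1 hd
    exact Or.inr ((g.mem_right_iff h₂ ha).1
      (hY.2 a ((σ.mem_combined_args E₁ s₀ s₁ s₂ h₀).2 (Or.inl ha)) hd'))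

/-- Supports of `F₂^⊛` have nonempty tails inside `A₂`, so sets disjoint from `A₂` are closed. -/
theorem _root_.Splitting.combined_cl_eq_of_disjoint (hsup : ∀ h, ((∅ : Set α), h) ∉ σ.F₂.sup) {V : Set α}
    (hV : V ∩ σ.F₂.args = ∅) : (σ.combined E₁ s₀ s₁ s₂ h₀).cl V = V := by
  refine (BSAF.isClosed_iff _).2 fun W a hW hWV => ?_
  have hno : ∀ x, x ∈ W → x ∉ σ.F₂.args := fun x hx hx' => by
    have : x ∈ V ∩ σ.F₂.args := ⟨hWV hx, hx'⟩
    rw [hV] at this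
    exact this
  have hTno : ∀ T ∈ σ.incompat E₁ s₀ h₀, W ≠ T ∩ σ.F₂.args := by
    rintro T hT rfl
    obtain ⟨h, -, hS, -⟩ := (σ.mem_incompat E₁ s₀ h₀).1 hT
    exact (σ.S₃_sub hS).2.1 (Set.eq_empty_of_forall_notMem fun x hx => hno x hx hx.2)
  rcases (σ.mem_combined_sup E₁ s₀ s₁ s₂ h₀).1 hW with h | ⟨T, hT, h, -⟩ | ⟨T, hT, h, -⟩
  · have : W = ∅ :=
      Set.eq_empty_of_forall_notMem fun x hx => hno x hx ((σ.F₂.sup_sub _ h).1 hx)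
    subst this
    exact absurd h (hsup a)
  · exact absurd h (hTno T hT.1)
  · exact absurd h (hTno T hT.1)

/-- A complete set `E₁ ∪ X` of `F` yields a complete set of `F₂^⊛`, provided that `*₂` is added
exactly when it is defended. -/
theorem complete_right (g : σ.Glued E₁ s₂ X Y) (hsup : ∀ h, ((∅ : Set α), h) ∉ σ.F₂.sup)
    (h₁ : s₁ ∉ F.args) (h₂ : s₂ ∉ F.args) (h₀₁ : s₀ ≠ s₁) (h₀₂ : s₀ ≠ s₂) (h₁₂ : s₁ ≠ s₂)
    (hE : F.Complete (E₁ ∪ X))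
    (hs₂ : s₂ ∈ Y ↔ s₂ ∈ (σ.combined E₁ s₀ s₁ s₂ h₀).args ∧
      (σ.combined E₁ s₀ s₁ s₂ h₀).Defends Y s₂) :
    (σ.combined E₁ s₀ s₁ s₂ h₀).Complete Y := by
  refine ⟨g.admissible_right h₁ h₂ h₀₁ h₀₂ h₁₂ hE.1 hs₂.1, fun a ha hd => ?_⟩
  rcases (σ.mem_combined_args E₁ s₀ s₁ s₂ h₀).1 ha with h | rfl | ⟨rfl, hne⟩ | ⟨rfl, -⟩
  · have hd' := (g.defends_iff h₁ h₂ h₀₁ h₀₂ h₁₂ hE.1.1.2 h).2 hd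
    exact g.subset (g.mem_of_right (hE.2 a (σ.sub₂.1 h) hd') h)
  -- `*₀` attacks itself and `{*₀}` is closed, but `Y` does not attack `*₀`.
  · rw [BSAF.defends_iff_cl] at hd
    obtain ⟨x, hx, hxY⟩ := hd {a} ((σ.mem_combined_att E₁ a s₁ s₂ h₀).2
      (Or.inl ((σ.mem_starF₂_att E₁ a).2 (Or.inr (Or.inr (Or.inl ⟨rfl, rfl⟩))))))
    rw [combined_cl_eq_of_disjoint hsup] at hx
    · exact absurd (hx ▸ hxY) (g.not_attackedBy_zero h₀₁ h₀₂)
    · exact Set.singleton_inter_eq_empty.2 fun h => h₀ (σ.sub₂.1 h)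
  -- `*₁` is attacked by the closed set `∅`.
  · rw [BSAF.defends_iff_cl] at hd
    obtain ⟨x, hx, -⟩ := hd ∅ ((σ.mem_combined_att E₁ s₀ a s₂ h₀).2
      (Or.inr (Or.inl ⟨rfl, rfl, hne⟩)))
    rw [combined_cl_eq_of_disjoint hsup (Set.empty_inter _)] at hx
    exact absurd hx (Set.notMem_empty x)
  · exact hs₂.2 ⟨ha, hd⟩

end Glued

/-- Conflict-freeness and closedness of `Y` in `F₂^⊛` exclude `*₀`, `*₁` and the projections of
support-incompatible tails. -/
theorem glued_of_admissible (h₂ : s₂ ∉ F.args) (hE₁ : σ.F₁.Admissible E₁) {Y : Set α}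
    (hY : (σ.combined E₁ s₀ s₁ s₂ h₀).Admissible Y) : σ.Glued E₁ s₂ (Y \ {s₂}) Y := by
  obtain ⟨⟨hYargs, hYcf⟩, hYcl, -⟩ := hY
  obtain ⟨⟨hA, hcf⟩, hcl, -⟩ := hE₁
  rw [BSAF.isClosed_iff] at hYcl hcl
  have hs₁ : s₁ ∈ Y → ¬ (σ.defeated E₁ s₀ h₀).Nonempty := fun h hne =>
    hYcf ⟨s₁, h, ∅, Set.empty_subset _,
      (σ.mem_combined_att E₁ s₀ s₁ s₂ h₀).2 (Or.inr (Or.inl ⟨rfl, rfl, hne⟩))⟩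
  have hs₀ : s₀ ∉ Y := fun h => hYcf ⟨s₀, h, {s₀}, Set.singleton_subset_iff.2 h,
    (σ.mem_combined_att E₁ s₀ s₁ s₂ h₀).2
      (Or.inl ((σ.mem_starF₂_att E₁ s₀).2 (Or.inr (Or.inr (Or.inl ⟨rfl, rfl⟩)))))⟩
  have hno : ∀ T ∈ σ.incompat E₁ s₀ h₀, ¬ T ∩ σ.F₂.args ⊆ Y := by
    intro T hT hTY
    by_cases hD : T ∈ σ.defeated E₁ s₀ h₀
    · exact hs₁ (hYcl _ s₁ ((σ.mem_combined_sup E₁ s₀ s₁ s₂ h₀).2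
        (Or.inr (Or.inl ⟨T, hD, rfl, rfl⟩))) hTY) ⟨T, hD⟩
    · have h := hYcl _ s₂ ((σ.mem_combined_sup E₁ s₀ s₁ s₂ h₀).2
        (Or.inr (Or.inr ⟨T, ⟨hT, hD⟩, rfl, rfl⟩))) hTY
      exact hYcf ⟨s₂, h, T ∩ σ.F₂.args ∪ {s₂}, Set.union_subset hTY (Set.singleton_subset_iff.2 h),
        (σ.mem_combined_att E₁ s₀ s₁ s₂ h₀).2 (Or.inr (Or.inr ⟨T, ⟨hT, hD⟩, rfl, rfl⟩))⟩
  have hX : Y \ {s₂} ⊆ σ.F₂.args := by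
    rintro x ⟨hx, hx2⟩
    rcases (σ.mem_combined_args E₁ s₀ s₁ s₂ h₀).1 (hYargs hx) with h | rfl | ⟨rfl, h⟩ | ⟨h, -⟩
    · exact h
    · exact absurd hx hs₀
    · exact absurd h (hs₁ hx)
    · exact absurd h hx2
  have hcf' : ∀ x ∈ E₁, x ∉ attackedBy σ.F₁.att E₁ := fun x hx h => hcf ⟨x, hx, h⟩
  refine ⟨hA, hX, hcf', ?_, ?_, Set.sdiff_subset, fun x hx => ?_⟩
  · rw [BSAF.isClosed_iff]
    intro T h hT hTE
    have hT1 : T ∩ σ.F₁.args ⊆ E₁ := fun x hx =>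
      (hTE hx.1).resolve_right fun h => σ.not_mem_right hx.2 (hX h)
    have hT2 : T ∩ σ.F₂.args ⊆ Y := fun x hx =>
      ((hTE hx.1).resolve_left fun h => σ.not_mem_right (hA h) hx.2).1
    have hT' := hT
    rw [σ.sup_eq] at hT'
    rcases hT' with (h' | h') | h'
    · exact Or.inl (hcl T h h' fun x hx => hT1 ⟨hx, (σ.F₁.sup_sub _ h').1 hx⟩)
    · have hs := σ.F₂.sup_sub _ h'
      refine Or.inr ⟨hYcl T h ((σ.mem_combined_sup E₁ s₀ s₁ s₂ h₀).2 (Or.inl h'))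
        fun x hx => hT2 ⟨hx, hs.1 hx⟩, fun h => h₂ (h ▸ σ.sub₂.1 hs.2)⟩
    · by_contra hh
      exact hno T ((σ.mem_incompat E₁ s₀ h₀).2 ⟨h, (σ.S₃_sub h').2.2.2, h', hT1,
        fun h => hh (Or.inl h)⟩) hT2
  -- A closed attack from inside `E₁` is projected to an attack from `∅`.
  · rintro x hx ⟨U, hU, hUx⟩
    refine hYcf ⟨x, hx.1, U ∩ σ.F₂.args, fun y hy => absurd hy.2 (σ.not_mem_right (hA (hU hy.1))),
      (σ.mem_combined_att E₁ s₀ s₁ s₂ h₀).2 (Or.inl ((σ.mem_starF₂_att E₁ s₀).2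
        (Or.inr (Or.inl ⟨U, hUx, ?_, Set.inter_subset_left.trans hU, rfl⟩))))⟩
    refine Set.eq_empty_of_forall_notMem ?_
    rintro y ⟨hy, W, hW, h | h⟩
    · exact hcf' y (hU hy) ⟨W, hW, h⟩
    · exact σ.not_mem_right (hA (hU hy)) (σ.hatR₃_sub _ h).2
  · by_cases h : x = s₂
    · exact Or.inr h
    · exact Or.inl ⟨hx, h⟩

/-- The traces on `A₁` and `A₂` of an admissible set of `F` are glued. -/
theorem glued_of_admissible_union {X Y : Set α} (hE₁ : E₁ ⊆ σ.F₁.args) (hX : X ⊆ σ.F₂.args)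
    (hE : F.Admissible (E₁ ∪ X)) (hXY : X ⊆ Y) (hYX : Y ⊆ X ∪ {s₂}) : σ.Glued E₁ s₂ X Y := by
  refine ⟨hE₁, hX, ?_, hE.2.1, ?_, hXY, hYX⟩
  · rintro x hx ⟨T, hT, h⟩
    exact hE.1.2 ⟨x, Or.inl hx, T, hT.trans Set.subset_union_left, σ.sub₁.2.1 h⟩
  · rintro x hx ⟨U, hU, h⟩
    exact hE.1.2 ⟨x, Or.inr hx, σ.attackedBy_of_hat (Or.inr h) (hU.trans Set.subset_union_left)⟩

theorem inter_union_inter {E : Set α} (hE : E ⊆ F.args) :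
    E ∩ σ.F₁.args ∪ E ∩ σ.F₂.args = E := by
  rw [← Set.inter_union_distrib_left, ← σ.args_eq]
  exact Set.inter_eq_left.2 hE

end Splitting

theorem mainTheorem6 {α : Type*} (F : BSAF α) (σ : Splitting F)
    (hsup : ∀ h, ((∅ : Set α), h) ∉ σ.F₂.sup)
    (s₀ s₁ s₂ : α) (h₀ : s₀ ∉ F.args) (h₁ : s₁ ∉ F.args) (h₂ : s₂ ∉ F.args)
    (h₀₁ : s₀ ≠ s₁) (h₀₂ : s₀ ≠ s₂) (h₁₂ : s₁ ≠ s₂) (E₁ E₂ : Set α) :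
    (σ.F₁.Grounded E₁ → (σ.combined E₁ s₀ s₁ s₂ h₀).Grounded E₂ →
      F.Grounded (E₁ ∪ (E₂ \ {s₂}))) ∧
    (σ.F₁.Preferred E₁ → (σ.combined E₁ s₀ s₁ s₂ h₀).Preferred E₂ →
      F.Preferred (E₁ ∪ (E₂ \ {s₂}))) := by
  constructor
  · intro hE₁ hE₂
    have g := Splitting.glued_of_admissible h₂ hE₁.prop.1 hE₂.prop.1
    refine ⟨g.complete hsup h₁ h₂ h₀₁ h₀₂ h₁₂ hE₁.prop hE₂.prop, fun E hE hle => ?_⟩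
    have hsub₁ : E ∩ σ.F₁.args ⊆ E₁ := fun x hx =>
      g.inter_left ▸ (⟨hle hx.1, hx.2⟩ : x ∈ (E₁ ∪ (E₂ \ {s₂})) ∩ σ.F₁.args)
    have heq₁ : E ∩ σ.F₁.args = E₁ := hE₁.eq_of_subset (σ.complete_left hsup hE) hsub₁
    have hsub₂ : E ∩ σ.F₂.args ⊆ E₂ \ {s₂} := fun x hx => g.mem_of_right (hle hx.1) hx.2
    have hEeq : E₁ ∪ E ∩ σ.F₂.args = E := by
      rw [← heq₁]
      exact Splitting.inter_union_inter hE.1.1.1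
    -- `*₂` is added to the trace of `E` on `A₂` exactly when this trace defends it.
    set Y : Set α := E ∩ σ.F₂.args ∪ {x | x = s₂ ∧ s₂ ∈ (σ.combined E₁ s₀ s₁ s₂ h₀).args ∧
      (σ.combined E₁ s₀ s₁ s₂ h₀).Defends (E ∩ σ.F₂.args) s₂} with hYdef
    have hYX : Y ⊆ E ∩ σ.F₂.args ∪ {s₂} := Set.union_subset_union_right _ fun x hx => hx.1
    rw [← hEeq] at hE
    have g' : σ.Glued E₁ s₂ (E ∩ σ.F₂.args) Y := Splitting.glued_of_admissible_union g.left
      Set.inter_subset_right hE.1 Set.subset_union_left hYX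
    have hY : (σ.combined E₁ s₀ s₁ s₂ h₀).Complete Y := by
      refine g'.complete_right hsup h₁ h₂ h₀₁ h₀₂ h₁₂ hE ⟨fun hs => ?_, fun hs => ?_⟩
      · rcases hs with hs | ⟨-, hs, hd⟩
        · exact absurd (σ.sub₂.1 hs.2) h₂
        · exact ⟨hs, hd.mono Set.subset_union_left⟩
      · refine Or.inr ⟨rfl, hs.1, fun D hD hDc hatt => ?_⟩
        obtain ⟨x, hx, hxY⟩ := hs.2 D hD hDc hatt
        exact ⟨x, hx, g'.attackedBy_subset h₁ h₂ h₀₁ h₀₂ h₁₂ hxY⟩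
    have hYE : Y ⊆ E₂ := by
      rintro x (hx | ⟨rfl, hx, hd⟩)
      · exact (hsub₂ hx).1
      · exact hE₂.prop.2 x hx (hd.mono (hsub₂.trans Set.sdiff_subset))
    have heq₂ : Y = E₂ := hE₂.eq_of_subset hY hYE
    refine hEeq ▸ Set.union_subset_union_right _ fun x hx => ?_
    exact (hYX (heq₂ ▸ hx.1)).resolve_right hx.2
  · intro hE₁ hE₂
    have g := Splitting.glued_of_admissible h₂ hE₁.prop hE₂.prop
    refine ⟨g.admissible hsup h₁ h₂ h₀₁ h₀₂ h₁₂ hE₁.prop hE₂.prop, fun E hE hle => ?_⟩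
    have hsub₁ : E₁ ⊆ E ∩ σ.F₁.args := fun x hx => ⟨hle (Or.inl hx), g.left hx⟩
    have heq₁ : E ∩ σ.F₁.args = E₁ :=
      (hE₁.eq_of_subset (σ.admissible_left hsup hE) hsub₁).symm
    have hEeq : E₁ ∪ E ∩ σ.F₂.args = E := by
      rw [← heq₁]
      exact Splitting.inter_union_inter hE.1.1
    have hX : E₂ \ {s₂} ⊆ E ∩ σ.F₂.args := fun x hx => ⟨hle (Or.inr hx), g.right hx⟩
    -- `E₂` is enlarged by the trace of `E` on `A₂`; it keeps `*₂` if it has it.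
    have hYX : E₂ ∪ E ∩ σ.F₂.args ⊆ E ∩ σ.F₂.args ∪ {s₂} := Set.union_subset
      (g.subset_union.trans (Set.union_subset_union_left _ hX)) Set.subset_union_left
    have hE' := hE
    rw [← hEeq] at hE'
    have g' : σ.Glued E₁ s₂ (E ∩ σ.F₂.args) (E₂ ∪ E ∩ σ.F₂.args) :=
      Splitting.glued_of_admissible_union g.left Set.inter_subset_right hE' Set.subset_union_right
        hYX
    have hadm : (σ.combined E₁ s₀ s₁ s₂ h₀).Admissible (E₂ ∪ E ∩ σ.F₂.args) := by
      refine g'.admissible_right h₁ h₂ h₀₁ h₀₂ h₁₂ hE' fun hs => ?_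
      have hs₂ : s₂ ∈ E₂ := hs.resolve_right fun h => h₂ (hE.1.1 h.1)
      exact ⟨hE₂.prop.1.1 hs₂, (hE₂.prop.2.2 s₂ hs₂).mono Set.subset_union_left⟩
    have heq₂ := hE₂.eq_of_subset hadm Set.subset_union_left
    rw [← hEeq]
    refine Set.union_subset_union_right _ fun x hx => ⟨heq₂ ▸ Or.inr hx, ?_⟩
    exact fun h => h₂ (h ▸ σ.sub₂.1 hx.2)
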